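/- An $\infty$-pseudo-metric space is a set $X$ with a symmetric function $\rho: X\times X\to[0,\infty]$ that vanishes on the diagonal and satisfies the triangle inequality. It has finite asymptotic dimension if there is an integer $n\ge 0$ such that for every real $r>0$ one can write $X=X_0\cup\dots\cup X_n$, where each $X_i$ is the union of a family $\mathcal U_i$ of subsets whose diameters are at most some real $S>0$ (depending on $r$), and points belonging to different members of $\mathcal U_i$ are at distance at least $r$. For $r>0$ and $A\subset X$, a scale-$r$-chain in $A$ is a finite sequence $x_0,\dots,x_k$ of points of $A$ such that the open balls $B(x_i,r)$ and $B(x_{i+1},r)$ of $X$ intersect for each $0\le i<k$. The scale-$r$-component of a point $x \in A$ is the set of all points that can be joined to $x$ by a scale-$r$-chain in $A$. The set $A$ is of scale-$r$-dimension $0$ if the diameters of its scale-$r$-components are bounded by one finite number. The space $X$ has Asymptotic Property C if for every sequence $(r_i)_{i\ge1}$ of positive real numbers there are a natural number $m$ and a decomposition $X=\bigcup_{i=1}^m X_i$ such that each $X_i$ is of scale-$r_i$-dimension $0$. **Corollary 7.7.** Let $D$ be an infinite countable set and let $\alpha: D\to(0,\infty)$ have limit infinity at infinity, i.e. for each $M>0$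 there is a finite set $E\subset D$ with $\alpha(d)>M$ for all $d\in D\setminus E$. Let $(X_d,\rho_d)$, $d\in D$, be $\infty$-pseudo-metric spaces, each of finite asymptotic dimension. Equip the cartesian product $\prod_{d\in D}X_d$ with the $\infty$-pseudo-metric $$\rho_\alpha(u,v)=\sum_{d\in D} r_d,\qquad r_d=\begin{cases}0 & \text{if } u(d)=v(d),\\ \alpha(d) & \text{if } u(d)\ne v(d)\text{ and }\rho_d(u(d),v(d))\le\alpha(d),\\ \rho_d(u(d),v(d)) & \text{if } u(d)\neq v(d)\text{ and }\rho_d(u(d),v(d))>\alpha(d).\end{cases}$$ Then the asymptotic product $(\prod_{d\in D}X_d,\rho_\alpha)$ has Asymptotic Property C. -/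

import Mathlib

open scoped ENNReal

/-! Spaces carrying a distance that is symmetric, vanishes on the diagonal, satisfies the triangle
inequality and may take the value `∞` are Mathlib's `PseudoEMetricSpace`s. -/

/-- The asymptotic dimension of `X` is at most `n`: for every `r > 0`, the space is the union of
subsets `X_0, …, X_n`, each the union of a uniformly bounded, `r`-disjoint family `U i`. -/
def AsdimLE (X : Type*) [PseudoEMetricSpace X] (n : ℕ) : Prop :=
  ∀ r : ℝ, 0 < r →
    ∃ U : Fin (n + 1) → Set (Set X),
      (⋃ i, ⋃₀ U i) = Set.univ ∧
      ∀ i,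
        (∃ S : ℝ, 0 < S ∧ ∀ A ∈ U i, Metric.ediam A ≤ ENNReal.ofReal S) ∧
        (∀ A ∈ U i, ∀ B ∈ U i, A ≠ B → ∀ x ∈ A, ∀ y ∈ B, ENNReal.ofReal r ≤ edist x y)

/-- `X` is of finite asymptotic dimension. -/
def HasFiniteAsdim (X : Type*) [PseudoEMetricSpace X] : Prop :=
  ∃ n : ℕ, AsdimLE X n

/-- One step of a scale-`r`-chain in `A`: both points lie in `A` and their open `r`-balls
(in the ambient space) meet. -/
def ScaleStep {X : Type*} [PseudoEMetricSpace X] (A : Set X) (r : ℝ) (x y : X) : Prop :=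
  x ∈ A ∧ y ∈ A ∧
    (Metric.eball x (ENNReal.ofReal r) ∩ Metric.eball y (ENNReal.ofReal r)).Nonempty

/-- The scale-`r`-component of `A` at `x`: all `y` joined to `x` by a (finite, possibly
one-point) scale-`r`-chain in `A`. It is empty if `x ∉ A`. -/
def scaleComponent {X : Type*} [PseudoEMetricSpace X] (A : Set X) (r : ℝ) (x : X) : Set X :=
  {y | x ∈ A ∧ y ∈ A ∧ Relation.ReflTransGen (ScaleStep A r) y x}

/-- `A` is of scale-`r`-dimension `0`: its scale-`r`-components are uniformly bounded. -/
def IsScaleDimZero {X : Type*} [PseudoEMetricSpace X] (A : Set X) (r : ℝ) : Prop :=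
  (⨆ x : X, Metric.ediam (scaleComponent A r x)) < ∞

/-- Asymptotic Property C. The `i`-th term `r i` of the sequence belongs to the `i`-th piece;
indices start at `0`. -/
def AsymptoticPropertyC (X : Type*) [PseudoEMetricSpace X] : Prop :=
  ∀ r : ℕ → ℝ, (∀ i, 0 < r i) →
    ∃ (m : ℕ) (Y : Fin m → Set X),
      (⋃ i, Y i) = Set.univ ∧ ∀ i : Fin m, IsScaleDimZero (Y i) (r i)

/-- The function `α` has limit infinity at infinity. -/
def HasLimitInfinityAtInfinity {D : Type*} (α : D → ℝ) : Prop :=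
  ∀ M : ℝ, 0 < M → ∃ E : Finset D, ∀ d, d ∉ E → M < α d

open scoped Classical in
/-- The contribution of one coordinate to the distance of an asymptotic product:
`0` if the two coordinates coincide, otherwise `a` if their distance is at most `a`, and their
distance if it exceeds `a`. -/
noncomputable def asymptoticTerm {X : Type*} [PseudoEMetricSpace X] (a : ℝ) (x y : X) : ℝ≥0∞ :=
  if x = y then 0 else if edist x y ≤ ENNReal.ofReal a then ENNReal.ofReal a else edist x y

theorem asymptoticTerm_self {X : Type*} [PseudoEMetricSpace X] (a : ℝ) (x : X) :
    asymptoticTerm a x x = 0 := by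
  simp [asymptoticTerm]

theorem asymptoticTerm_of_ne {X : Type*} [PseudoEMetricSpace X] (a : ℝ) {x y : X} (h : x ≠ y) :
    asymptoticTerm a x y = max (ENNReal.ofReal a) (edist x y) := by
  unfold asymptoticTerm
  rw [if_neg h]
  split_ifs with h1
  · exact (max_eq_left h1).symm
  · exact (max_eq_right (le_of_not_ge h1)).symm

theorem asymptoticTerm_comm {X : Type*} [PseudoEMetricSpace X] (a : ℝ) (x y : X) :
    asymptoticTerm a x y = asymptoticTerm a y x := by
  by_cases h : x = y
  · rw [h]
  · rw [asymptoticTerm_of_ne a h, asymptoticTerm_of_ne a (Ne.symm h), edist_comm]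

theorem asymptoticTerm_triangle {X : Type*} [PseudoEMetricSpace X] (a : ℝ) (x y z : X) :
    asymptoticTerm a x z ≤ asymptoticTerm a x y + asymptoticTerm a y z := by
  by_cases hxz : x = z
  · subst hxz
    simp [asymptoticTerm_self]
  by_cases hxy : x = y
  · subst hxy
    simp [asymptoticTerm_self]
  by_cases hyz : y = z
  · subst hyz
    simp [asymptoticTerm_self]
  rw [asymptoticTerm_of_ne a hxz, asymptoticTerm_of_ne a hxy, asymptoticTerm_of_ne a hyz]
  refine max_le ((le_max_left _ (edist x y)).trans le_self_add) ?_
  exact (edist_triangle x y z).trans (add_le_add (le_max_right _ _) (le_max_right _ _))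

/-- The underlying set of the asymptotic product: the full cartesian product (a type synonym, so
that it does not carry the supremum distance). -/
def AsymptoticProduct {D : Type*} (_α : D → ℝ) (X : D → Type*) : Type _ :=
  ∀ d, X d

/-- The distance of the asymptotic product: the (possibly infinite) sum over all coordinates of
`asymptoticTerm (α d)`. -/
noncomputable instance AsymptoticProduct.instPseudoEMetricSpace {D : Type*} (α : D → ℝ)
    (X : D → Type*) [∀ d, PseudoEMetricSpace (X d)] :
    PseudoEMetricSpace (AsymptoticProduct α X) where
  edist u v := ∑' d, asymptoticTerm (α d) (u d) (v d)
  edist_self u := by simp [asymptoticTerm_self]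
  edist_comm u v := tsum_congr fun d => asymptoticTerm_comm (α d) (u d) (v d)
  edist_triangle u v w := by
    rw [← ENNReal.tsum_add]
    exact ENNReal.tsum_le_tsum fun d => asymptoticTerm_triangle (α d) (u d) (v d) (w d)

open Relation

/-! Large `α` freezes coordinates: only a finite set `F` can move at scale `r 0`, and only a finite
`E` at any of the later scales used. The number of pieces must be fixed before `E` is known, so it
may depend on the colors of the `F`-coordinates alone. The unknown number of colors on `G = E \ F`
is instead encoded by shells: a point whose `G`-color has index `n` is tested against the `n`-th
shell around each color class of the `F`-product. Off these shells, an `r 0`-chain fixes `n` and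
cannot leave the neighbourhood of its initial class (`edist_le_of_chain_avoiding_shells`). On them,
position and the parity of `n` determine `n` along a chain (`colorShell_index_eq`), so finitely many
pieces suffice. -/

/-- Monochromatic chains with steps shorter than `r` have endpoints at distance at most `S`. -/
def IsBoundedColoring {X C : Type*} [PseudoEMetricSpace X] (κ : X → C) (r S : ℝ≥0∞) : Prop :=
  ∀ x y, ReflTransGen (fun a b => κ a = κ b ∧ edist a b < r) x y → edist x y ≤ S

/-- `X` has bounded colorings with colors in `C` at every finite scale. -/
def HasBoundedColorings (X C : Type*) [PseudoEMetricSpace X] : Prop :=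
  ∀ r : ℝ≥0∞, r ≠ ∞ → ∃ (κ : X → C) (S : ℝ≥0∞), S ≠ ∞ ∧ IsBoundedColoring κ r S

/-- Color each point by a family that covers it; disjointness keeps a monochromatic chain inside one
member. -/
theorem AsdimLE.hasBoundedColorings {X : Type*} [PseudoEMetricSpace X] {n : ℕ}
    (h : AsdimLE X n) : HasBoundedColorings X (Fin (n + 1)) := by
  intro r hr
  -- `r` may be `0`, while the scale must be positive.
  obtain ⟨U, hU, hUi⟩ := h (r.toReal + 1) (by positivity)
  have hle : r ≤ ENNReal.ofReal (r.toReal + 1) :=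
    (ENNReal.le_ofReal_iff_toReal_le hr (by positivity)).2 (by linarith)
  choose hS hdisj using hUi
  choose S _ hS using hS
  have hex : ∀ x : X, ∃ i, ∃ A ∈ U i, x ∈ A := by
    intro x
    have : x ∈ ⋃ i, ⋃₀ U i := hU ▸ Set.mem_univ x
    simpa using this
  choose κ A hA hxA using hex
  refine ⟨κ, ∑ i, ENNReal.ofReal (S i), by simp, fun x y hxy => ?_⟩
  have key : κ x = κ y ∧ y ∈ A x := by
    induction hxy with
    | refl => exact ⟨rfl, hxA x⟩
    | @tail b c _ hbc ih =>
      refine ⟨ih.1.trans hbc.1, ?_⟩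
      by_contra hc
      have hne : A x ≠ A c := fun he => hc (he ▸ hxA c)
      have hmem : A c ∈ U (κ x) := (ih.1.trans hbc.1) ▸ hA c
      exact absurd (hle.trans (hdisj (κ x) _ (hA x) _ hmem hne b ih.2 c (hxA c))) hbc.2.not_ge
  calc edist x y ≤ Metric.ediam (A x) := Metric.edist_le_ediam_of_mem (hxA x) key.2
    _ ≤ ENNReal.ofReal (S (κ x)) := hS _ _ (hA x)
    _ ≤ _ := Finset.single_le_sum (f := fun i => ENNReal.ofReal (S i)) (fun _ _ => zero_le)
        (Finset.mem_univ _)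

theorem HasBoundedColorings.pi {ι : Type*} [Fintype ι] {X C : ι → Type*}
    [∀ i, PseudoEMetricSpace (X i)] (h : ∀ i, HasBoundedColorings (X i) (C i)) :
    HasBoundedColorings (∀ i, X i) (∀ i, C i) := by
  intro r hr
  choose κ S hS hκ using fun i => h i r hr
  refine ⟨fun x i => κ i (x i), ∑ i, S i, by simpa using hS, fun x y hxy => ?_⟩
  refine edist_pi_le_iff.2 fun i => ?_
  refine (hκ i _ _ (hxy.lift (fun z => z i) fun a b hab => ?_)).trans
    (Finset.single_le_sum (f := S) (fun _ _ => zero_le) (Finset.mem_univ i))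
  exact ⟨congrFun hab.1 i, (edist_le_pi_edist a b i).trans_lt hab.2⟩

/-! ### Shells around color classes -/

/-- The points at distance at most `n * ε` from a point of color `j`. -/
def colorNhd {X C : Type*} [PseudoEMetricSpace X] (κ : X → C) (ε : ℝ≥0∞) (j : C) (n : ℕ) :
    Set X :=
  {x | ∃ p, κ p = j ∧ edist x p ≤ n * ε}

/-- The shell of points entering the neighbourhoods of the color class `j` at step `n + 1`. -/
def colorShell {X C : Type*} [PseudoEMetricSpace X] (κ : X → C) (ε : ℝ≥0∞) (j : C) (n : ℕ) :
    Set X :=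
  colorNhd κ ε j (n + 1) \ colorNhd κ ε j n

section Shells

variable {X C : Type*} [PseudoEMetricSpace X] {κ : X → C} {ε : ℝ≥0∞} {j : C}

theorem colorNhd_mono {m n : ℕ} (h : m ≤ n) : colorNhd κ ε j m ⊆ colorNhd κ ε j n := by
  rintro x ⟨p, hp, hx⟩
  exact ⟨p, hp, hx.trans (by gcongr)⟩

theorem mem_colorNhd_self (x : X) (n : ℕ) : x ∈ colorNhd κ ε (κ x) n := ⟨x, rfl, by simp⟩

theorem colorNhd_succ_of_edist_le {a b : X} {n : ℕ} (ha : a ∈ colorNhd κ ε j n)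
    (hab : edist a b ≤ ε) : b ∈ colorNhd κ ε j (n + 1) := by
  obtain ⟨p, hp, hx⟩ := ha
  refine ⟨p, hp, ?_⟩
  calc edist b p ≤ edist a b + edist a p := edist_triangle_left b p a
    _ ≤ ε + n * ε := add_le_add hab hx
    _ = _ := by push_cast; ring

theorem colorShell_index_le {a b : X} {m n : ℕ} (ha : a ∈ colorShell κ ε j m)
    (hb : b ∈ colorShell κ ε j n) (hab : edist a b ≤ ε) : n ≤ m + 1 := by
  by_contra! h
  exact hb.2 (colorNhd_mono (by omega) (colorNhd_succ_of_edist_le ha.1 hab))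

/-- A step of length at most `ε` changes the shell index by at most one, so parity pins it down. -/
theorem colorShell_index_eq {a b : X} {m n : ℕ} (ha : a ∈ colorShell κ ε j m)
    (hb : b ∈ colorShell κ ε j n) (hab : edist a b ≤ ε) (hmn : m % 2 = n % 2) : m = n := by
  have h1 := colorShell_index_le ha hb hab
  have h2 := colorShell_index_le hb ha (edist_comm a b ▸ hab)
  omega

/-- Chains avoiding the `n`-th shells of all colors are bounded. -/
theorem edist_le_of_chain_avoiding_shells {S : ℝ≥0∞} {n k : ℕ} (hn : n ≤ k) (hε : ε ≠ 0)
    (hε' : ε ≠ ∞) (hκ : IsBoundedColoring κ ((2 * k + 2) * ε) S) {x y : X}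
    (h : ReflTransGen
      (fun a b => (∀ i, b ∉ colorShell κ ε i n) ∧ edist a b ≤ ε) x y) :
    edist x y ≤ k * ε + S + k * ε := by
  classical
  -- The chain is shadowed by points `p` of the color of `x`. Leaving the `n`-th neighbourhood would
  -- mean landing in the `n`-th shell.
  have key : ∃ p, κ p = κ x ∧ edist y p ≤ k * ε ∧
      ReflTransGen (fun a b => κ a = κ b ∧ edist a b < (2 * k + 2) * ε) x p ∧
      y ∈ colorNhd κ ε (κ x) n := by
    induction h with
    | refl => exact ⟨x, rfl, by simp, .refl, mem_colorNhd_self x n⟩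
    | @tail b c _ hbc ih =>
      obtain ⟨p, hp, hbp, hch, hb⟩ := ih
      have hc : c ∈ colorNhd κ ε (κ x) n := by
        by_contra hc
        exact hbc.1 _ ⟨colorNhd_succ_of_edist_le hb hbc.2, hc⟩
      obtain ⟨q, hq, hcq⟩ := colorNhd_mono hn hc
      refine ⟨q, hq, hcq, hch.tail ⟨hp.trans hq.symm, ?_⟩, hc⟩
      calc edist p q ≤ edist p b + edist b c + edist c q := edist_triangle4 p b c q
        _ ≤ k * ε + ε + k * ε := add_le_add (add_le_add (edist_comm b p ▸ hbp) hbc.2) hcq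
        _ = (2 * k + 1) * ε := by ring
        _ < (2 * k + 2) * ε := by
          refine (ENNReal.mul_lt_mul_iff_left hε hε').2 ?_
          exact_mod_cast Nat.lt_succ_self (2 * k + 1)
  obtain ⟨p, _, hyp, hch, _⟩ := key
  calc edist x y ≤ edist x p + edist p y := edist_triangle _ _ _
    _ ≤ S + k * ε := add_le_add (hκ _ _ hch) (edist_comm y p ▸ hyp)
    _ ≤ k * ε + S + k * ε := by gcongr; exact le_add_self

end Shells

/-- Centers of meeting `r`-balls are less than `2 * r` apart. -/
theorem isScaleDimZero_of_chain_le {X : Type*} [PseudoEMetricSpace X] {A : Set X} {r : ℝ}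
    {B : ℝ≥0∞} (hB : B ≠ ∞)
    (h : ∀ x y, x ∈ A → ReflTransGen
      (fun a b => a ∈ A ∧ b ∈ A ∧ edist a b < ENNReal.ofReal (2 * r)) x y → edist x y ≤ B) :
    IsScaleDimZero A r := by
  refine lt_of_le_of_lt (iSup_le fun x => Metric.ediam_le fun y hy z hz => ?_)
    (ENNReal.add_lt_top.2 ⟨hB.lt_top, hB.lt_top⟩)
  have hstep : ∀ a b, ScaleStep A r a b →
      a ∈ A ∧ b ∈ A ∧ edist a b < ENNReal.ofReal (2 * r) := by
    rintro a b ⟨ha, hb, w, hwa, hwb⟩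
    refine ⟨ha, hb, ?_⟩
    calc edist a b ≤ edist w a + edist w b := edist_triangle_left a b w
      _ < ENNReal.ofReal r + ENNReal.ofReal r := ENNReal.add_lt_add hwa hwb
      _ = ENNReal.ofReal (2 * r) := by
        rw [ENNReal.ofReal_mul (by norm_num), ENNReal.ofReal_ofNat, two_mul]
  exact (edist_triangle_right y z x).trans
    (add_le_add (h _ _ hy.2.1 (ReflTransGen.mono hstep _ _ hy.2.2)) (h _ _ hz.2.1 (ReflTransGen.mono hstep _ _ hz.2.2)))

theorem edist_le_asymptoticTerm {X : Type*} [PseudoEMetricSpace X] (a : ℝ) (x y : X) :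
    edist x y ≤ asymptoticTerm a x y := by
  by_cases h : x = y
  · simp [h]
  · rw [asymptoticTerm_of_ne a h]; exact le_max_right _ _

theorem asymptoticTerm_le {X : Type*} [PseudoEMetricSpace X] (a : ℝ) (x y : X) :
    asymptoticTerm a x y ≤ ENNReal.ofReal a + edist x y := by
  by_cases h : x = y
  · simp [h, asymptoticTerm_self]
  · rw [asymptoticTerm_of_ne a h]; exact max_le le_self_add le_add_self

/-! ### Coordinates of the asymptotic product -/

namespace AsymptoticProduct

variable {D : Type*} {α : D → ℝ} {X : D → Type*} [∀ d, PseudoEMetricSpace (X d)]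

theorem asymptoticTerm_le_edist (u v : AsymptoticProduct α X) (d : D) :
    asymptoticTerm (α d) (u d) (v d) ≤ edist u v :=
  ENNReal.le_tsum (f := fun d => asymptoticTerm (α d) (u d) (v d)) d

theorem edist_apply_le (u v : AsymptoticProduct α X) (d : D) :
    edist (u d) (v d) ≤ edist u v :=
  (edist_le_asymptoticTerm _ _ _).trans (asymptoticTerm_le_edist u v d)

theorem apply_eq_of_edist_lt {u v : AsymptoticProduct α X} {R : ℝ}
    (h : edist u v < ENNReal.ofReal R) {d : D} (hd : R ≤ α d) : u d = v d := by
  by_contra hne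
  have := asymptoticTerm_le_edist u v d
  rw [asymptoticTerm_of_ne _ hne] at this
  exact absurd ((ENNReal.ofReal_le_ofReal hd).trans ((le_max_left _ _).trans this)) h.not_ge

theorem edist_le_sum {u v : AsymptoticProduct α X} {F : Finset D} {S : ℝ≥0∞}
    (hout : ∀ d ∉ F, u d = v d) (hin : ∀ d ∈ F, edist (u d) (v d) ≤ S) :
    edist u v ≤ ∑ d ∈ F, (ENNReal.ofReal (α d) + S) := by
  have : edist u v = ∑ d ∈ F, asymptoticTerm (α d) (u d) (v d) :=
    tsum_eq_sum fun d hd => by rw [hout d hd, asymptoticTerm_self]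
  rw [this]
  exact Finset.sum_le_sum fun d hd => (asymptoticTerm_le _ _ _).trans (by gcongr; exact hin d hd)

theorem apply_eq_of_chain {r : AsymptoticProduct α X → AsymptoticProduct α X → Prop} {R : ℝ}
    (hr : ∀ a b, r a b → edist a b < ENNReal.ofReal R) {u v : AsymptoticProduct α X}
    (h : ReflTransGen r u v) {d : D} (hd : R ≤ α d) : u d = v d := by
  induction h with
  | refl => rfl
  | tail _ hbc ih => exact ih.trans (apply_eq_of_edist_lt (hr _ _ hbc) hd)

/-- The projection to finitely many coordinates, with the supremum distance. -/
def proj (F : Finset D) (u : AsymptoticProduct α X) : ∀ d : F, X d := fun d => u d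

theorem edist_proj_le (F : Finset D) (u v : AsymptoticProduct α X) :
    edist (proj F u) (proj F v) ≤ edist u v :=
  edist_pi_le_iff.2 fun d => edist_apply_le u v d

end AsymptoticProduct

open AsymptoticProduct in
theorem corollary7p7 {D : Type*} [Countable D] [Infinite D]
    (α : D → ℝ) (hα : ∀ d, 0 < α d) (hlim : HasLimitInfinityAtInfinity α)
    (X : D → Type*) [∀ d, PseudoEMetricSpace (X d)]
    (hX : ∀ d, HasFiniteAsdim (X d)) :
    AsymptoticPropertyC (AsymptoticProduct α X) := by
  classical
  intro r hr
  choose n hn using hX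
  obtain ⟨F, hF⟩ := hlim (2 * r 0) (by linarith [hr 0])
  let C := ∀ d : F, Fin (n d + 1)
  let e : C × Fin 2 × C ≃ Fin (Fintype.card (C × Fin 2 × C)) := Fintype.equivFin _
  -- `K` depends on `F` only, so `R` can dominate every scale in use before `E` is chosen.
  set K := Fintype.card (C × Fin 2 × C)
  let R : ℝ := ∑ i ∈ Finset.range (K + 1), 2 * r i
  have hrR : ∀ i ≤ K, 2 * r i ≤ R := fun i hi =>
    Finset.single_le_sum (f := fun i => 2 * r i) (fun i _ => by linarith [hr i])
      (Finset.mem_range.2 (by omega))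
  have hR : 0 < R := lt_of_lt_of_le (by linarith [hr 0]) (hrR 0 (Nat.zero_le _))
  obtain ⟨E, hE⟩ := hlim R hR
  let G : Finset D := E \ F
  let C' := ∀ d : G, Fin (n d + 1)
  let k : ℕ := Fintype.card C'
  let e' : C' ≃ Fin k := Fintype.equivFin C'
  let ε : ℝ≥0∞ := ENNReal.ofReal R
  have hε : ε ≠ 0 := (ENNReal.ofReal_pos.2 hR).ne'
  have hε' : ε ≠ ∞ := ENNReal.ofReal_ne_top
  have hT : ((2 * k + 2) * ε : ℝ≥0∞) ≠ ∞ := ENNReal.mul_ne_top (by finiteness) hε'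
  have hεT : ε ≤ (2 * k + 2) * ε :=
    le_mul_of_one_le_left zero_le (by exact_mod_cast (by omega : 1 ≤ 2 * k + 2))
  obtain ⟨κ, S, hS, hκ⟩ :=
    HasBoundedColorings.pi (fun d : F => (hn d).hasBoundedColorings) _ hT
  obtain ⟨κ', S', hS', hκ'⟩ :=
    HasBoundedColorings.pi (fun d : G => (hn d).hasBoundedColorings) ε hε'
  let c : AsymptoticProduct α X → ℕ := fun u => e' (κ' (proj G u))
  have hck : ∀ u, c u ≤ k := fun u => (e' (κ' (proj G u))).2.le
  have hstep : ∀ {i : ℕ} {a b : AsymptoticProduct α X}, i ≤ K →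
      edist a b < ENNReal.ofReal (2 * r i) → edist a b < ε := fun hi h =>
    h.trans_le (ENNReal.ofReal_le_ofReal (hrR _ hi))
  let Y₀ : Set (AsymptoticProduct α X) := {u | ∀ j, proj F u ∉ colorShell κ ε j (c u)}
  let Y₁ : C × Fin 2 × C → Set (AsymptoticProduct α X) := fun t =>
    {u | proj F u ∈ colorShell κ ε t.1 (c u) ∧ c u % 2 = t.2.1 ∧ κ (proj F u) = t.2.2}
  refine ⟨K + 1, Fin.cons Y₀ fun i => Y₁ (e.symm i), ?_, ?_⟩
  · refine Set.eq_univ_of_forall fun u => Set.mem_iUnion.2 ?_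
    by_cases hu : u ∈ Y₀
    · exact ⟨0, hu⟩
    · obtain ⟨j, hj⟩ : ∃ j, proj F u ∈ colorShell κ ε j (c u) := by simpa [Y₀] using hu
      refine ⟨(e (j, ⟨c u % 2, Nat.mod_lt _ two_pos⟩, κ (proj F u))).succ, ?_⟩
      simp only [Fin.cons_succ, Equiv.symm_apply_apply]
      exact ⟨hj, rfl, rfl⟩
  · refine Fin.cases ?_ fun i => ?_
    · refine isScaleDimZero_of_chain_le
        (B := ∑ d ∈ F, (ENNReal.ofReal (α d) + (k * ε + S + k * ε)))
        (ENNReal.sum_ne_top.2 fun _ _ => by finiteness) ?_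
      intro u v _ huv
      have hconst : ∀ {w}, ReflTransGen (fun a b => a ∈ Y₀ ∧ b ∈ Y₀ ∧
          edist a b < ENNReal.ofReal (2 * r 0)) u w → ∀ d ∉ F, u d = w d := fun h d hd =>
        apply_eq_of_chain (fun _ _ h => h.2.2) h (hF d hd).le
      refine edist_le_sum (hconst huv) fun d hd => ?_
      -- `c` reads only coordinates in `G`, which are disjoint from `F` and hence frozen.
      have hc : ∀ {w}, (∀ d ∉ F, u d = w d) → c w = c u := fun {w} hw => by
        have : proj G u = proj G w := funext fun d => hw d (Finset.mem_sdiff.1 d.2).2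
        simp only [c, this]
      refine (edist_le_pi_edist (proj F u) (proj F v) ⟨d, hd⟩).trans
        (edist_le_of_chain_avoiding_shells (hck u) hε hε' hκ ?_)
      clear hd
      induction huv with
      | refl => exact .refl
      | tail hab hbc ih =>
        refine ih.tail ⟨fun j => ?_, ?_⟩
        · rw [← hc (hconst (hab.tail hbc))]
          exact hbc.2.1 j
        · exact (edist_proj_le F _ _).trans (hstep (Nat.zero_le _) hbc.2.2).le
    · have hi : (i.succ : ℕ) ≤ K := by simp
      refine isScaleDimZero_of_chain_le
        (B := ∑ d ∈ F ∪ E, (ENNReal.ofReal (α d) + (S + S')))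
        (ENNReal.sum_ne_top.2 fun _ _ => by finiteness) ?_
      intro u v _ huv
      refine edist_le_sum (fun d hd => ?_) fun d hd => ?_
      · exact apply_eq_of_chain (fun _ _ h => hstep hi h.2.2) huv
          (hE d fun h => hd (Finset.mem_union_right _ h)).le
      by_cases hdF : d ∈ F
      · refine (edist_le_pi_edist (proj F u) (proj F v) ⟨d, hdF⟩).trans
          ((hκ _ _ (huv.lift _ fun a b hab => ⟨?_, ?_⟩)).trans le_self_add)
        · exact hab.1.2.2.trans hab.2.1.2.2.symm
        · exact ((edist_proj_le F a b).trans_lt (hstep hi hab.2.2)).trans_le hεT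
      · have hdG : d ∈ G := Finset.mem_sdiff.2 ⟨(Finset.mem_union.1 hd).resolve_left hdF, hdF⟩
        refine (edist_le_pi_edist (proj G u) (proj G v) ⟨d, hdG⟩).trans
          ((hκ' _ _ (huv.lift _ fun a b hab => ⟨?_, ?_⟩)).trans le_add_self)
        -- Equal shell indices mean equal `G`-colors, since `c` is an injective numbering of them.
        · refine e'.injective (Fin.ext (colorShell_index_eq hab.1.1 hab.2.1.1 ?_ ?_))
          · exact (edist_proj_le F a b).trans (hstep hi hab.2.2).le
          · exact hab.1.2.1.trans hab.2.1.2.1.symm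
        · exact (edist_proj_le G a b).trans_lt (hstep hi hab.2.2)
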